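/- Let $n\ge 2$ and $p\ge 2$, and let $c_1,\dots,c_{p+1}\subset gl(n,\mathbb{C})$ (resp. $C_1,\dots,C_{p+1}\subset GL(n,\mathbb{C})$) be conjugacy classes, one of which consists of matrices with $n$ distinct eigenvalues. Suppose that the weak Deligne--Simpson problem is solvable for these classes, i.e. there exist matrices $A_j\in c_j$ with $A_1+\dots+A_{p+1}=0$ (resp. $M_j\in C_j$ with $M_1M_2\cdots M_{p+1}=I$) such that the only matrices commuting with all the $A_j$ (resp. with all the $M_j$) are the scalar ones. For every $j$, let $d_j$ be the dimension of the $j$-th class as an algebraic variety, and let $r_j=\min_{\lambda\in\mathbb{C}}\operatorname{rank}(Y-\lambda I)$ for any matrix $Y$ in the $j$-th class. Then $$(\alpha_n)\qquad d_1+\dots+d_{p+1}\ \ge\ 2n^2-2,$$ $$(\beta_n)\qquad \sum_{i\ne j} r_i\ \ge\ n\quad\text{for every } j\in\{1,\dots,p+1\}.$$ -/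

import Mathlib

/-- The `n × n` complex matrices, i.e. `gl(n, ℂ)`. -/
abbrev Mat (n : ℕ) : Type := Matrix (Fin n) (Fin n) ℂ

/-- The general linear group `GL(n, ℂ)`. -/
abbrev GLn (n : ℕ) : Type := GL (Fin n) ℂ

/-- The set of matrices belonging to a conjugacy class of `GL(n, ℂ)`, viewed inside `gl(n, ℂ)`. -/
def groupClassSet {n : ℕ} (C : ConjClasses (GLn n)) : Set (Mat n) :=
  (fun M : GLn n => (M : Mat n)) '' C.carrier

/-- The dimension of a (locally closed) set `S` of matrices as an algebraic variety: the Krull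
dimension of the coordinate ring of its Zariski closure, that is, of the ring of polynomials in the
`n²` matrix entries modulo the polynomials vanishing on `S`. -/
noncomputable def varietyDim {n : ℕ} (S : Set (Mat n)) : WithBot ℕ∞ :=
  ringKrullDim (MvPolynomial (Fin n × Fin n) ℂ ⧸
    MvPolynomial.vanishingIdeal ℂ
      ((fun (A : Mat n) (ij : Fin n × Fin n) => A ij.1 ij.2) '' S))

/-- `min_{μ ∈ ℂ} rank (Y - μ I)` for a matrix `Y`. -/
noncomputable def matrixMinRank {n : ℕ} (Y : Mat n) : ℕ :=
  ⨅ μ : ℂ, (Y - μ • (1 : Mat n)).rank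

/-- `r(S)` for a conjugacy class `S`: the value of `matrixMinRank` on the elements of `S`
(on a conjugacy class it is constant, see `minRank_eq`). -/
noncomputable def minRank {n : ℕ} (S : Set (Mat n)) : ℕ :=
  sInf (matrixMinRank '' S)

theorem matrixMinRank_eq_of_isConj {n : ℕ} {Y Z : Mat n} (h : IsConj Y Z) :
    matrixMinRank Y = matrixMinRank Z := by
  obtain ⟨Q, hQ⟩ := h
  have hdet : IsUnit (Q : Mat n).det := (Matrix.isUnit_iff_isUnit_det _).1 Q.isUnit
  unfold matrixMinRank
  refine iInf_congr fun μ => ?_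
  have key : (Q : Mat n) * (Y - μ • (1 : Mat n)) = (Z - μ • (1 : Mat n)) * (Q : Mat n) := by
    rw [mul_sub, sub_mul, hQ.eq]
    simp
  calc (Y - μ • (1 : Mat n)).rank = ((Q : Mat n) * (Y - μ • (1 : Mat n))).rank :=
        (Matrix.rank_mul_eq_right_of_isUnit_det _ _ hdet).symm
    _ = ((Z - μ • (1 : Mat n)) * (Q : Mat n)).rank := by rw [key]
    _ = (Z - μ • (1 : Mat n)).rank := Matrix.rank_mul_eq_left_of_isUnit_det _ _ hdet

theorem minRank_eq {n : ℕ} {c : ConjClasses (Mat n)} {Y : Mat n} (hY : Y ∈ c.carrier) :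
    minRank c.carrier = matrixMinRank Y := by
  have : matrixMinRank '' c.carrier = {matrixMinRank Y} := by
    ext k
    constructor
    · rintro ⟨Z, hZ, rfl⟩
      refine matrixMinRank_eq_of_isConj (ConjClasses.mk_eq_mk_iff_isConj.1 ?_)
      rw [ConjClasses.mem_carrier_iff_mk_eq.1 hZ, ConjClasses.mem_carrier_iff_mk_eq.1 hY]
    · rintro rfl
      exact ⟨Y, hY, rfl⟩
  rw [minRank, this, csInf_singleton]

/-- The matrices in `S` have `n` distinct eigenvalues. -/
def HasDistinctEigenvalues {n : ℕ} (S : Set (Mat n)) : Prop :=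
  ∀ A ∈ S, (spectrum ℂ A).ncard = n

/-- The centralizer of the tuple is trivial, i.e. it consists of the scalar matrices only. -/
def TrivialCentralizer {n : ℕ} {ι : Type*} (A : ι → Mat n) : Prop :=
  ∀ X : Mat n, (∀ j, X * A j = A j * X) → ∃ a : ℂ, X = a • (1 : Mat n)

/-- Solvability of the weak Deligne-Simpson problem (additive version). -/
def AdditiveWeakDSPSolvable {n p : ℕ} (c : Fin (p + 1) → ConjClasses (Mat n)) : Prop :=
  ∃ A : Fin (p + 1) → Mat n,
    (∀ j, A j ∈ (c j).carrier) ∧ ∑ j, A j = 0 ∧ TrivialCentralizer A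

/-- Solvability of the weak Deligne-Simpson problem (multiplicative version); the product
`M₁ M₂ ⋯ M_{p+1}` is taken in this order. -/
def MultiplicativeWeakDSPSolvable {n p : ℕ} (C : Fin (p + 1) → ConjClasses (GLn n)) : Prop :=
  ∃ M : Fin (p + 1) → GLn n,
    (∀ j, M j ∈ (C j).carrier) ∧ (List.ofFn M).prod = 1 ∧
      TrivialCentralizer (fun j => (M j : Mat n))

/-- Condition `(α_n)`: `d₁ + ⋯ + d_{p+1} ≥ 2 n² - 2`. -/
def ConditionAlpha {n p : ℕ} (S : Fin (p + 1) → Set (Mat n)) : Prop :=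
  ((2 * n ^ 2 - 2 : ℕ) : WithBot ℕ∞) ≤ ∑ j, varietyDim (S j)

/-- Condition `(β_n)`: for every `j`, the sum of all `r_i` with `i ≠ j` is at least `n`. -/
def ConditionBeta {n p : ℕ} (S : Fin (p + 1) → Set (Mat n)) : Prop :=
  ∀ j, n ≤ ∑ i ∈ Finset.univ.erase j, minRank (S i)

/-! For `(α_n)`: the orbit of `A` has the image of `X ↦ X * A - A * X` as tangent space at `A`, so
the rank of this map bounds the dimension of the class from below. Scott's lemma bounds the sum of
these ranks, using a complex `V → ∏ j, range D_j → V`. The kernel of the first map is the common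
centralizer; the cokernel of the second embeds in it by trace duality. Both have dimension at most
1. For `(β_n)`: if the sum is less than `n`, the matrices other than the `j`-th share a right
eigenvector `v` and a left eigenvector `w`. Then `v wᵀ` commutes with them, hence with the `j`-th by
the relation, but it is not scalar. -/

/-! ### Krull dimension and algebraic independence -/

theorem ringKrullDim_le_of_isIntegral_of_injective {R S : Type*} [CommRing R] [CommRing S]
    [IsDomain S] [Algebra R S] [Algebra.IsIntegral R S] (h : Function.Injective (algebraMap R S)) :
    ringKrullDim R ≤ ringKrullDim S := by
  refine iSup_le fun l => ?_
  have hker : RingHom.ker (algebraMap R S) ≤ l.head.asIdeal := by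
    rw [(RingHom.injective_iff_ker_eq_bot _).1 h]
    exact bot_le
  obtain ⟨P, hP, hPl⟩ := Ideal.exists_ideal_over_prime_of_isIntegral_of_isDomain l.head.asIdeal hker
  have : P.LiesOver l.head.asIdeal := ⟨hPl.symm⟩
  obtain ⟨L, hL, -, -⟩ := Ideal.exists_ltSeries_of_hasGoingUp l P
  rw [← hL]
  exact Order.LTSeries.length_le_krullDim L

/-- Noether normalization makes `R` integral over a polynomial ring in `s` variables: transcendence
degree gives `d ≤ s`, going up gives `s ≤ dim R`. -/
theorem natCast_le_ringKrullDim_of_isDomain {k R : Type} [Field k] [CommRing R] [IsDomain R]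
    [Algebra k R] [Algebra.FiniteType k R] {d : ℕ} (f : MvPolynomial (Fin d) k →ₐ[k] R)
    (hf : Function.Injective f) : (d : WithBot ℕ∞) ≤ ringKrullDim R := by
  obtain ⟨s, g, hg, hgi⟩ := exists_integral_inj_algHom_of_fg k R
  let : Algebra (MvPolynomial (Fin s) k) R := g.toRingHom.toAlgebra
  have : IsScalarTower k (MvPolynomial (Fin s) k) R :=
    IsScalarTower.of_algebraMap_eq fun x => (g.commutes x).symm
  have : Algebra.IsIntegral (MvPolynomial (Fin s) k) R := ⟨hgi⟩
  have hinj : Function.Injective (algebraMap (MvPolynomial (Fin s) k) R) := hg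
  have : FaithfulSMul (MvPolynomial (Fin s) k) R :=
    (faithfulSMul_iff_algebraMap_injective _ _).2 hinj
  have h1 := trdeg_add_eq k (MvPolynomial (Fin s) k) (A := R)
  rw [trdeg_eq_zero (R := MvPolynomial (Fin s) k), add_zero] at h1
  have h2 := trdeg_le_of_injective f hf
  rw [← h1] at h2
  simp only [MvPolynomial.trdeg_of_isDomain, Cardinal.mk_fin, Cardinal.lift_natCast,
    Nat.cast_le] at h2
  have h3 := ringKrullDim_le_of_isIntegral_of_injective hinj
  rw [MvPolynomial.ringKrullDim_of_isNoetherianRing, ringKrullDim_eq_zero_of_field, zero_add,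
    Nat.card_fin] at h3
  exact le_trans (by exact_mod_cast h2) h3

/-- A finitely generated algebra containing `d` algebraically independent elements has Krull
dimension at least `d`. -/
theorem natCast_le_ringKrullDim {k R : Type} [Field k] [CommRing R]
    [Algebra k R] [Algebra.FiniteType k R] {d : ℕ} (f : MvPolynomial (Fin d) k →ₐ[k] R)
    (hf : Function.Injective f) : (d : WithBot ℕ∞) ≤ ringKrullDim R := by
  have hbot : (⊥ : Ideal (MvPolynomial (Fin d) k)) ∈ minimalPrimes (MvPolynomial (Fin d) k) := by
    rw [IsDomain.minimalPrimes_eq_singleton_bot]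
    rfl
  -- A prime `q` contracting to zero keeps the map into `R ⧸ q` injective, which reduces to domains.
  obtain ⟨q, hq, hqc⟩ :=
    Ideal.exists_comap_eq_of_mem_minimalPrimes_of_injective (f := f.toRingHom) hf _ hbot
  refine le_trans (natCast_le_ringKrullDim_of_isDomain ((Ideal.Quotient.mkₐ k q).comp f) ?_)
    (ringKrullDim_quotient_le q)
  refine (injective_iff_map_eq_zero _).2 fun x hx => ?_
  have : x ∈ q.comap f.toRingHom :=
    (Ideal.Quotient.eq_zero_iff_mem (I := q)).1 hx
  rwa [hqc] at this

theorem MvPolynomial.eq_zero_of_eventually_eval_eq_zero {d : ℕ} {P : MvPolynomial (Fin d) ℂ}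
    {x : Fin d → ℂ} (h : ∀ᶠ y in nhds x, MvPolynomial.eval y P = 0) : P = 0 := by
  rw [nhds_pi, Filter.eventually_iff, Filter.mem_pi] at h
  obtain ⟨I, -, t, ht, hsub⟩ := h
  refine MvPolynomial.funext_set t (fun i => infinite_of_mem_nhds (x i) (ht i)) fun y hy => ?_
  rw [map_zero]
  exact hsub fun i _ => hy i trivial

/-! ### Dimension of an orbit -/

/-- The commutator with `A`, the tangent map at the identity of `g ↦ g A g⁻¹`. -/
noncomputable def commutatorMap {n : ℕ} (A : Mat n) : Mat n →ₗ[ℂ] Mat n :=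
  LinearMap.mulRight ℂ A - LinearMap.mulLeft ℂ A

@[simp]
theorem commutatorMap_apply {n : ℕ} (A X : Mat n) : commutatorMap A X = X * A - A * X := rfl

section

attribute [local instance] Matrix.linftyOpNormedRing Matrix.linftyOpNormedAlgebra

theorem hasStrictFDerivAt_conj {n : ℕ} (A : Mat n) :
    HasStrictFDerivAt (fun g : Mat n => g * A * Ring.inverse g)
      (LinearMap.toContinuousLinearMap (commutatorMap A)) 1 := by
  have h1 : HasStrictFDerivAt (𝕜 := ℂ) (fun g : Mat n => g * A) _ 1 :=
    (hasStrictFDerivAt_id (𝕜 := ℂ) 1).mul_const' A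
  have h2 := hasStrictFDerivAt_ringInverse (𝕜 := ℂ) (1 : (Mat n)ˣ)
  have h3 := h1.mul' h2
  refine h3.congr_fderiv ?_
  ext1 X
  change _ = X * A - A * X
  simp [sub_eq_add_neg, add_comm]

/-- A strictly differentiable map with surjective derivative is open at the point; invertible
matrices form a neighbourhood of 1. -/
theorem eventually_mem_image_conj {n d : ℕ} (A : Mat n) (L : Mat n →ₗ[ℂ] (Fin d → ℂ))
    (hL : Function.Surjective (L ∘ₗ commutatorMap A)) :
    ∀ᶠ y in nhds (L A), ∃ g : GLn n, y = L (g * A * (g⁻¹ : GLn n)) := by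
  have h1 := (LinearMap.toContinuousLinearMap L).hasStrictFDerivAt.comp 1 (hasStrictFDerivAt_conj A)
  have h2 := h1.map_nhds_eq_of_surj (LinearMap.range_eq_top.2 hL)
  have h3 : ∀ᶠ g : Mat n in nhds 1, IsUnit g := Units.isOpen.mem_nhds isUnit_one
  have h4 : LinearMap.toContinuousLinearMap L (1 * A * Ring.inverse 1) = L A := by simp
  rw [h4] at h2
  rw [← h2, Filter.eventually_map]
  filter_upwards [h3] with g hg
  obtain ⟨u, rfl⟩ := hg
  exact ⟨u, by simp⟩

end

theorem exists_surjective_comp {K V : Type*} [Field K] [AddCommGroup V] [Module K V]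
    [FiniteDimensional K V] (T : V →ₗ[K] V) :
    ∃ L : V →ₗ[K] (Fin (Module.finrank K (LinearMap.range T)) → K),
      Function.Surjective (L ∘ₗ T) := by
  obtain ⟨π, hπ⟩ := (LinearMap.range T).subtype.exists_leftInverse_of_injective
    (Submodule.ker_subtype _)
  let e := (Module.finBasis K (LinearMap.range T)).equivFun
  refine ⟨e.toLinearMap ∘ₗ π, fun y => ?_⟩
  obtain ⟨x, hx⟩ := (e.symm y).2
  refine ⟨x, ?_⟩
  have : π (T x) = e.symm y := by
    rw [hx]
    exact LinearMap.congr_fun hπ (e.symm y)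
  simp [this]

/-- A set of matrices containing the orbit of `A` has dimension at least that of the tangent space
of the orbit at `A`. -/
theorem finrank_range_commutatorMap_le_varietyDim {n : ℕ} {S : Set (Mat n)} {A : Mat n}
    (hS : ∀ g : GLn n, (g : Mat n) * A * (g⁻¹ : GLn n) ∈ S) :
    (Module.finrank ℂ (LinearMap.range (commutatorMap A)) : WithBot ℕ∞) ≤ varietyDim S := by
  obtain ⟨L, hL⟩ := exists_surjective_comp (commutatorMap A)
  -- The components of `L` as linear forms in the matrix entries; they will be algebraically
  -- independent on `S`.
  let coord : Fin (Module.finrank ℂ (LinearMap.range (commutatorMap A))) →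
      MvPolynomial (Fin n × Fin n) ℂ := fun i =>
    ∑ kl : Fin n × Fin n, MvPolynomial.C (L (Matrix.single kl.1 kl.2 1) i) * MvPolynomial.X kl
  have hcoord : ∀ (B : Mat n) i,
      MvPolynomial.aeval (fun ij : Fin n × Fin n => B ij.1 ij.2) (coord i) = L B i := by
    intro B i
    conv_rhs => rw [Matrix.matrix_eq_sum_single B]
    simp only [coord, map_sum, Finset.sum_apply, Fintype.sum_prod_type]
    refine Finset.sum_congr rfl fun k _ => Finset.sum_congr rfl fun l _ => ?_
    have : Matrix.single k l (B k l) = B k l • Matrix.single k l (1 : ℂ) := by simp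
    rw [this, map_smul]
    simp [mul_comm]
  refine natCast_le_ringKrullDim ((Ideal.Quotient.mkₐ ℂ _).comp (MvPolynomial.aeval coord)) ?_
  refine (injective_iff_map_eq_zero _).2 fun P hP => ?_
  have hP' := MvPolynomial.mem_vanishingIdeal_iff.1 (Ideal.Quotient.eq_zero_iff_mem.1 hP)
  -- A relation `P` vanishes on the image under `L` of the orbit, which contains a neighbourhood of
  -- `L A`.
  refine MvPolynomial.eq_zero_of_eventually_eval_eq_zero (x := L A) ?_
  filter_upwards [eventually_mem_image_conj A L hL] with y hy
  obtain ⟨g, rfl⟩ := hy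
  have h := hP' _ (Set.mem_image_of_mem _ (hS g))
  change MvPolynomial.aeval _ (MvPolynomial.aeval coord P) = 0 at h
  rw [← AlgHom.comp_apply, MvPolynomial.comp_aeval] at h
  simp only [hcoord] at h
  exact h

/-! ### Scott's lemma and the rank bound -/

/-- Scott's lemma, in the form of a rank count for a complex `V → ∏ j, V → V`. -/
theorem two_mul_finrank_sub_two_le_sum_finrank_range {K V ι : Type*} [Field K] [AddCommGroup V]
    [Module K V] [FiniteDimensional K V] [Fintype ι] (D ψ : ι → V →ₗ[K] V)
    (hzero : ∑ j, ψ j ∘ₗ D j = 0)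
    (hker : Module.finrank K (⨅ j, LinearMap.ker (D j) : Submodule K V) ≤ 1)
    (hann : Module.finrank K
      ((⨆ j, LinearMap.range (ψ j ∘ₗ D j) : Submodule K V).dualAnnihilator) ≤ 1) :
    2 * Module.finrank K V - 2 ≤ ∑ j, Module.finrank K (LinearMap.range (D j)) := by
  let Φ : V →ₗ[K] (∀ j, LinearMap.range (D j)) := LinearMap.pi fun j => (D j).rangeRestrict
  let Ψ : (∀ j, LinearMap.range (D j)) →ₗ[K] V :=
    ∑ j, ψ j ∘ₗ (LinearMap.range (D j)).subtype ∘ₗ LinearMap.proj j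
  have hkerΦ : LinearMap.ker Φ = ⨅ j, LinearMap.ker (D j) := by
    simp only [Φ, LinearMap.ker_pi, LinearMap.ker_rangeRestrict]
  have hΨΦ : LinearMap.range Φ ≤ LinearMap.ker Ψ := by
    rintro _ ⟨v, rfl⟩
    have := LinearMap.congr_fun hzero v
    simpa [Φ, Ψ] using this
  have hrange : (⨆ j, LinearMap.range (ψ j ∘ₗ D j)) ≤ LinearMap.range Ψ := by
    classical
    refine iSup_le fun j => ?_
    rintro _ ⟨v, rfl⟩
    refine ⟨Pi.single j ⟨D j v, v, rfl⟩, ?_⟩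
    simp only [Ψ, LinearMap.sum_apply, LinearMap.comp_apply, LinearMap.proj_apply,
      Submodule.subtype_apply]
    rw [Finset.sum_eq_single j]
    · simp
    · intro i _ hij
      simp [Pi.single_eq_of_ne hij]
    · simp
  have h1 := Φ.finrank_range_add_finrank_ker
  have h2 := Ψ.finrank_range_add_finrank_ker
  have h3 := Submodule.finrank_mono hΨΦ
  have h4 := Submodule.finrank_mono hrange
  have h5 := Subspace.finrank_add_finrank_dualAnnihilator_eq
    (⨆ j, LinearMap.range (ψ j ∘ₗ D j) : Submodule K V)
  rw [hkerΦ] at h1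
  rw [Module.finrank_pi_fintype] at h2
  -- `dim V - 1 ≤ rank Φ ≤ dim ker Ψ = ∑ rank D_j - rank Ψ`, and `rank Ψ ≥ dim V - 1`.
  omega

theorem finrank_span_singleton_le_one {K V : Type*} [Field K] [AddCommGroup V] [Module K V]
    {W : Submodule K V} {v : V} (h : ∀ w ∈ W, ∃ a : K, w = a • v) : Module.finrank K W ≤ 1 := by
  have hW : W ≤ Submodule.span K {v} := fun w hw => by
    obtain ⟨a, rfl⟩ := h w hw
    exact Submodule.smul_mem _ _ (Submodule.mem_span_singleton_self v)
  exact (Submodule.finrank_mono hW).trans (by simpa using finrank_span_le_card ({v} : Set V))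

theorem exists_dual_eq_trace_mul {n : ℕ} (f : Module.Dual ℂ (Mat n)) :
    ∃ Y : Mat n, ∀ X, f X = (Y * X).trace := by
  refine ⟨Matrix.of fun i j => f (Matrix.single j i 1), fun X => ?_⟩
  conv_lhs => rw [Matrix.matrix_eq_sum_single X]
  simp only [map_sum, Matrix.trace, Matrix.diag, Matrix.mul_apply, Matrix.of_apply]
  rw [Finset.sum_comm]
  refine Finset.sum_congr rfl fun j _ => Finset.sum_congr rfl fun i _ => ?_
  have : Matrix.single i j (X i j) = X i j • Matrix.single i j (1 : ℂ) := by simp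
  rw [this, map_smul, smul_eq_mul, mul_comm]

theorem eq_of_trace_mul_eq {n : ℕ} {Y Z : Mat n} (h : ∀ X : Mat n, (Y * X).trace = (Z * X).trace) :
    Y = Z :=
  Matrix.ext_iff_trace_mul_right.2 h

theorem finrank_iInf_ker_commutatorMap_le_one {n : ℕ} {ι : Type*} {A : ι → Mat n}
    (hA : TrivialCentralizer A) :
    Module.finrank ℂ (⨅ j, LinearMap.ker (commutatorMap (A j)) : Submodule ℂ (Mat n)) ≤ 1 := by
  refine finrank_span_singleton_le_one (v := 1) fun X hX => hA X fun j => ?_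
  have := (Submodule.mem_iInf _).1 hX j
  rwa [LinearMap.mem_ker, commutatorMap_apply, sub_eq_zero] at this

/-- Functionals are `X ↦ tr (Y * X)`; by `hψ` those killing all the images have `Y` in the
centralizer, so they are multiples of the trace. -/
theorem sum_finrank_range_commutatorMap_of_centralizer {n : ℕ} {ι : Type*} [Fintype ι]
    {A : ι → Mat n} (hA : TrivialCentralizer A) (ψ : ι → Mat n →ₗ[ℂ] Mat n)
    (hzero : ∑ j, ψ j ∘ₗ commutatorMap (A j) = 0)
    (hψ : ∀ Y : Mat n, (∀ j X, (Y * ψ j (commutatorMap (A j) X)).trace = 0) →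
      ∀ j, Y * A j = A j * Y) :
    2 * n ^ 2 - 2 ≤ ∑ j, Module.finrank ℂ (LinearMap.range (commutatorMap (A j))) := by
  have key := two_mul_finrank_sub_two_le_sum_finrank_range (fun j => commutatorMap (A j)) ψ hzero
    (finrank_iInf_ker_commutatorMap_le_one hA) ?_
  · rwa [Module.finrank_matrix, Module.finrank_self, Fintype.card_fin, mul_one, ← sq] at key
  refine finrank_span_singleton_le_one (v := Matrix.traceLinearMap (Fin n) ℂ ℂ) fun f hf => ?_
  obtain ⟨Y, hY⟩ := exists_dual_eq_trace_mul f
  obtain ⟨a, rfl⟩ := hA Y <| hψ Y fun j X => by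
    rw [← hY]
    exact (Submodule.mem_dualAnnihilator f).1 hf _
      (Submodule.mem_iSup_of_mem j (LinearMap.mem_range_self _ X))
  exact ⟨a, LinearMap.ext fun X => by simp [hY]⟩

theorem sum_finrank_range_commutatorMap_of_sum_eq_zero {n : ℕ} {ι : Type*} [Fintype ι]
    {A : ι → Mat n} (hA : TrivialCentralizer A) (hsum : ∑ j, A j = 0) :
    2 * n ^ 2 - 2 ≤ ∑ j, Module.finrank ℂ (LinearMap.range (commutatorMap (A j))) := by
  refine sum_finrank_range_commutatorMap_of_centralizer hA (fun _ => LinearMap.id) ?_ ?_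
  · ext1 X
    simp [← Finset.mul_sum, ← Finset.sum_mul, hsum]
  · intro Y hY j
    refine (eq_of_trace_mul_eq fun X => ?_).symm
    have := hY j X
    simp only [LinearMap.id_apply, commutatorMap_apply, mul_sub, Matrix.trace_sub,
      sub_eq_zero] at this
    rw [mul_assoc (Y), ← this, ← mul_assoc Y, Matrix.trace_mul_comm (Y * X), mul_assoc]

theorem partialProd_last {G : Type*} [Monoid G] {m : ℕ} (f : Fin m → G) :
    Fin.partialProd f (Fin.last m) = (List.ofFn f).prod := by
  simp [Fin.partialProd, List.take_of_length_le]

/-- With partial products `P`, twisting the `j`-th commutator by `ψ j` gives a difference of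
consecutive conjugations, so the sum telescopes. -/
theorem sum_finrank_range_commutatorMap_of_prod_eq_one {n m : ℕ} {M : Fin m → GLn n}
    (hM : TrivialCentralizer fun j => (M j : Mat n)) (hprod : (List.ofFn M).prod = 1) :
    2 * n ^ 2 - 2 ≤ ∑ j, Module.finrank ℂ (LinearMap.range (commutatorMap (M j : Mat n))) := by
  let P : Fin (m + 1) → GLn n := Fin.partialProd M
  have hP0 : P 0 = 1 := Fin.partialProd_zero M
  have hPs : ∀ j : Fin m, P j.succ = P j.castSucc * M j := Fin.partialProd_succ M
  have hPl : P (Fin.last m) = 1 := (partialProd_last M).trans hprod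
  let T : Fin (m + 1) → Mat n →ₗ[ℂ] Mat n := fun i =>
    LinearMap.mulLeft ℂ (P i : Mat n) ∘ₗ LinearMap.mulRight ℂ ((P i)⁻¹ : GLn n).val
  let ψ : Fin m → Mat n →ₗ[ℂ] Mat n := fun j =>
    LinearMap.mulLeft ℂ (P j.castSucc : Mat n) ∘ₗ LinearMap.mulRight ℂ ((P j.succ)⁻¹ : GLn n).val
  have hψ : ∀ j, ψ j ∘ₗ commutatorMap (M j : Mat n) = T j.castSucc - T j.succ := by
    intro j
    ext1 X
    simp only [ψ, T, hPs, LinearMap.comp_apply, LinearMap.mulLeft_apply, LinearMap.mulRight_apply,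
      commutatorMap_apply, LinearMap.sub_apply, mul_inv_rev, Units.val_mul, sub_mul, mul_sub]
    congr 1
    · rw [mul_assoc X, Units.mul_inv_cancel_left]
    · simp only [mul_assoc]
  refine sum_finrank_range_commutatorMap_of_centralizer hM ψ ?_ ?_
  · simp only [hψ]
    rw [Finset.sum_sub_distrib, sub_eq_zero]
    have h1 := Fin.sum_univ_castSucc T
    have h2 := Fin.sum_univ_succ T
    have h3 : T 0 = T (Fin.last m) := by simp only [T, hP0, hPl]
    rw [h2, h3, add_comm] at h1
    exact (add_right_cancel h1).symm
  · intro Y hY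
    -- Dually, the conjugates of `Y` by successive `P i` agree, and the first is `Y` itself.
    have hstep : ∀ j : Fin m, ((P j.succ)⁻¹ : GLn n).val * Y * P j.succ =
        ((P j.castSucc)⁻¹ : GLn n).val * Y * P j.castSucc := by
      intro j
      refine eq_of_trace_mul_eq fun X => ?_
      have h := hY j X
      rw [← LinearMap.comp_apply, hψ, LinearMap.sub_apply, mul_sub, Matrix.trace_sub,
        sub_eq_zero] at h
      have hT : ∀ i, (Y * T i X).trace = (((P i)⁻¹ : GLn n).val * Y * P i * X).trace := by
        intro i
        simp only [T, LinearMap.comp_apply, LinearMap.mulLeft_apply, LinearMap.mulRight_apply]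
        rw [← mul_assoc, ← mul_assoc, Matrix.trace_mul_comm]
        simp only [mul_assoc]
      rw [← hT, ← hT, h]
    have hall : ∀ i, ((P i)⁻¹ : GLn n).val * Y * P i = Y := by
      intro i
      induction i using Fin.induction with
      | zero => simp [hP0]
      | succ j ih => rw [hstep, ih]
    have hcomm : ∀ i, Y * P i = P i * Y := fun i => by
      conv_rhs => rw [← hall i, mul_assoc, Units.mul_inv_cancel_left]
    intro j
    have h := hcomm j.succ
    rw [hPs, Units.val_mul, ← mul_assoc, hcomm, mul_assoc, mul_assoc] at h
    exact (P j.castSucc).isUnit.mul_left_cancel h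

/-! ### Common eigenvectors and `(β_n)` -/

theorem exists_rank_sub_smul_one_eq_matrixMinRank {n : ℕ} (Y : Mat n) :
    ∃ μ : ℂ, (Y - μ • (1 : Mat n)).rank = matrixMinRank Y :=
  ciInf_mem fun μ : ℂ => (Y - μ • (1 : Mat n)).rank

theorem minRank_eq_of_forall {n : ℕ} {S : Set (Mat n)} {A : Mat n} (hA : A ∈ S)
    (h : ∀ B ∈ S, IsConj B A) : minRank S = matrixMinRank A := by
  have : matrixMinRank '' S = {matrixMinRank A} := by
    ext k
    constructor
    · rintro ⟨B, hB, rfl⟩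
      exact matrixMinRank_eq_of_isConj (h B hB)
    · rintro rfl
      exact ⟨A, hA, rfl⟩
  rw [minRank, this, csInf_singleton]

theorem exists_common_ker_of_sum_rank_lt {n : ℕ} {ι : Type*} (s : Finset ι) (B : ι → Mat n)
    (h : ∑ i ∈ s, (B i).rank < n) : ∃ v : Fin n → ℂ, v ≠ 0 ∧ ∀ i ∈ s, (B i).mulVec v = 0 := by
  let F : (Fin n → ℂ) →ₗ[ℂ] (∀ i : s, LinearMap.range (B i).mulVecLin) :=
    LinearMap.pi fun i => (B i).mulVecLin.rangeRestrict
  have hF : LinearMap.ker F ≠ ⊥ := by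
    refine LinearMap.ker_ne_bot_of_finrank_lt ?_
    rw [Module.finrank_pi_fintype, Module.finrank_fin_fun]
    exact (Finset.sum_coe_sort s fun i => (B i).rank).trans_lt h
  obtain ⟨v, hv, hv0⟩ := Submodule.exists_mem_ne_zero_of_ne_bot hF
  refine ⟨v, hv0, fun i hi => ?_⟩
  have := congrArg Subtype.val (congrFun (LinearMap.mem_ker.1 hv) ⟨i, hi⟩)
  exact this

theorem vecMulVec_ne_smul_one {n : ℕ} (hn : 2 ≤ n) {v w : Fin n → ℂ} (hv : v ≠ 0) (hw : w ≠ 0)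
    (a : ℂ) : Matrix.vecMulVec v w ≠ a • (1 : Mat n) := by
  intro h
  have hr := Matrix.rank_vecMulVec_le v w
  rw [h] at hr
  by_cases ha : a = 0
  · rw [ha, zero_smul] at h
    obtain ⟨i, hi⟩ := Function.ne_iff.1 hv
    obtain ⟨j, hj⟩ := Function.ne_iff.1 hw
    exact mul_ne_zero hi hj (congrFun (congrFun h i) j)
  · have hu : IsUnit (a • (1 : Mat n)) :=
      (Matrix.isUnit_iff_isUnit_det _).2 (by simp [ha])
    rw [Matrix.rank_of_isUnit _ hu, Fintype.card_fin] at hr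
    omega

/-- If the ranks of the `A i - μ i` with `i ∈ s` add up to less than `n`, the `A i` have a common
right and a common left eigenvector for the same eigenvalues; their product commutes with all
the `A i`. -/
theorem exists_not_scalar_commute {n : ℕ} (hn : 2 ≤ n) {ι : Type*} (s : Finset ι) (A : ι → Mat n)
    (h : ∑ i ∈ s, matrixMinRank (A i) < n) :
    ∃ X : Mat n, (∀ a : ℂ, X ≠ a • (1 : Mat n)) ∧ ∀ i ∈ s, X * A i = A i * X := by
  choose μ hμ using fun i => exists_rank_sub_smul_one_eq_matrixMinRank (A i)
  obtain ⟨v, hv0, hv⟩ := exists_common_ker_of_sum_rank_lt s (fun i => A i - μ i • 1)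
    (by simpa only [hμ] using h)
  -- Transposing preserves ranks, so the same bound yields a left eigenvector.
  obtain ⟨w, hw0, hw⟩ := exists_common_ker_of_sum_rank_lt s (fun i => (A i - μ i • 1).transpose)
    (by simpa only [Matrix.rank_transpose, hμ] using h)
  refine ⟨Matrix.vecMulVec v w, vecMulVec_ne_smul_one hn hv0 hw0, fun i hi => ?_⟩
  have h1 : (A i - μ i • 1) * Matrix.vecMulVec v w = 0 := by
    rw [Matrix.mul_vecMulVec, hv i hi, Matrix.zero_vecMulVec]
  have h2 : Matrix.vecMulVec v w * (A i - μ i • 1) = 0 := by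
    rw [Matrix.vecMulVec_mul, ← Matrix.mulVec_transpose, hw i hi, Matrix.vecMulVec_zero]
  rw [sub_mul, sub_eq_zero] at h1
  rw [mul_sub, sub_eq_zero] at h2
  rw [h1, h2]
  simp

theorem le_sum_erase_matrixMinRank {n : ℕ} (hn : 2 ≤ n) {ι : Type*} [Fintype ι] [DecidableEq ι]
    {A : ι → Mat n} (hA : TrivialCentralizer A)
    (hrel : ∀ X : Mat n, ∀ j, (∀ i, i ≠ j → X * A i = A i * X) → X * A j = A j * X) (j : ι) :
    n ≤ ∑ i ∈ Finset.univ.erase j, matrixMinRank (A i) := by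
  by_contra! h
  obtain ⟨X, hX, hcomm⟩ := exists_not_scalar_commute hn _ A h
  have hne : ∀ i, i ≠ j → X * A i = A i * X := fun i hi =>
    hcomm i (Finset.mem_erase.2 ⟨hi, Finset.mem_univ i⟩)
  obtain ⟨a, ha⟩ := hA X fun i => by
    by_cases hi : i = j
    · rw [hi]
      exact hrel X j hne
    · exact hne i hi
  exact hX a ha

theorem commute_of_sum_eq_zero {n : ℕ} {ι : Type*} [Fintype ι] {A : ι → Mat n}
    (hsum : ∑ j, A j = 0) (X : Mat n) (j : ι) (h : ∀ i, i ≠ j → X * A i = A i * X) :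
    X * A j = A j * X := by
  classical
  have hj : A j = -∑ i ∈ Finset.univ.erase j, A i := by
    rw [eq_neg_iff_add_eq_zero, Finset.add_sum_erase _ _ (Finset.mem_univ j), hsum]
  have : Commute X (∑ i ∈ Finset.univ.erase j, A i) :=
    Commute.sum_right _ _ _ fun i hi => h i (Finset.ne_of_mem_erase hi)
  rw [hj]
  exact this.neg_right

/-- `X` commutes with the partial products up to position `j` (from the left end) and after it (from
the right end); `M j` is the quotient of the two adjacent ones. -/
theorem commute_of_prod_eq_one {n m : ℕ} {M : Fin m → GLn n} (hprod : (List.ofFn M).prod = 1)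
    (X : Mat n) (j : Fin m) (h : ∀ i, i ≠ j → X * (M i : Mat n) = M i * X) :
    X * (M j : Mat n) = M j * X := by
  let P : Fin (m + 1) → GLn n := Fin.partialProd M
  have hP0 : P 0 = 1 := Fin.partialProd_zero M
  have hPs : ∀ j : Fin m, P j.succ = P j.castSucc * M j := Fin.partialProd_succ M
  have hPl : P (Fin.last m) = 1 := (partialProd_last M).trans hprod
  have hlow : ∀ i : Fin (m + 1), i ≤ j.castSucc → Commute X (P i : Mat n) := by
    intro i
    induction i using Fin.induction with
    | zero => intro _; rw [hP0]; exact Commute.one_right X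
    | succ i ih =>
      intro hi
      have hlt : i < j := Fin.succ_le_castSucc_iff.1 hi
      rw [hPs, Units.val_mul]
      exact (ih (Fin.castSucc_le_castSucc_iff.2 hlt.le)).mul_right (h i hlt.ne)
  have hhigh : ∀ i : Fin (m + 1), j.succ ≤ i → Commute X (P i : Mat n) := by
    intro i
    induction i using Fin.reverseInduction with
    | last => intro _; rw [hPl]; exact Commute.one_right X
    | cast i ih =>
      intro hi
      have hlt : j < i := Fin.succ_le_castSucc_iff.1 hi
      have hMi : Commute X (M i : Mat n) := h i hlt.ne'
      have h1 : (P i.castSucc : Mat n) = P i.succ * ((M i)⁻¹ : GLn n) := by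
        rw [hPs, Units.val_mul, mul_assoc, Units.mul_inv, mul_one]
      rw [h1]
      exact (ih (Fin.succ_le_succ_iff.2 hlt.le)).mul_right hMi.units_inv_right
  have h1 : (M j : Mat n) = ((P j.castSucc)⁻¹ : GLn n) * P j.succ := by
    rw [hPs, Units.val_mul, Units.inv_mul_cancel_left]
  rw [h1]
  exact ((hlow _ le_rfl).units_inv_right).mul_right (hhigh _ le_rfl)

/-! ### Passage to conjugacy classes -/

theorem mem_carrier_conj {n : ℕ} {c : ConjClasses (Mat n)} {A : Mat n} (hA : A ∈ c.carrier)
    (g : GLn n) : (g : Mat n) * A * (g⁻¹ : GLn n) ∈ c.carrier := by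
  rw [ConjClasses.mem_carrier_iff_mk_eq] at hA ⊢
  rw [← hA, ConjClasses.mk_eq_mk_iff_isConj]
  exact IsConj.symm ⟨g, by simp [SemiconjBy, mul_assoc]⟩

theorem mem_groupClassSet_conj {n : ℕ} {C : ConjClasses (GLn n)} {M : GLn n} (hM : M ∈ C.carrier)
    (g : GLn n) : (g : Mat n) * M * (g⁻¹ : GLn n) ∈ groupClassSet C := by
  refine ⟨g * M * g⁻¹, ?_, by simp⟩
  rw [ConjClasses.mem_carrier_iff_mk_eq] at hM ⊢
  rw [← hM, ConjClasses.mk_eq_mk_iff_isConj]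
  exact (isConj_iff.2 ⟨g, rfl⟩).symm

theorem minRank_groupClassSet_eq {n : ℕ} {C : ConjClasses (GLn n)} {M : GLn n}
    (hM : M ∈ C.carrier) : minRank (groupClassSet C) = matrixMinRank (M : Mat n) := by
  refine minRank_eq_of_forall ⟨M, hM, rfl⟩ ?_
  rintro _ ⟨N, hN, rfl⟩
  rw [ConjClasses.mem_carrier_iff_mk_eq] at hM hN
  exact (Units.coeHom (Mat n)).map_isConj (ConjClasses.mk_eq_mk_iff_isConj.1 (hN.trans hM.symm))

theorem conditionAlpha_of_le_sum_finrank {n p : ℕ} {S : Fin (p + 1) → Set (Mat n)}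
    {A : Fin (p + 1) → Mat n} (hS : ∀ j (g : GLn n), (g : Mat n) * A j * (g⁻¹ : GLn n) ∈ S j)
    (h : 2 * n ^ 2 - 2 ≤ ∑ j, Module.finrank ℂ (LinearMap.range (commutatorMap (A j)))) :
    ConditionAlpha S := by
  refine le_trans (b := ((∑ j, Module.finrank ℂ (LinearMap.range (commutatorMap (A j))) : ℕ) :
    WithBot ℕ∞)) (by exact_mod_cast h) ?_
  rw [Nat.cast_sum]
  exact Finset.sum_le_sum fun j _ => finrank_range_commutatorMap_le_varietyDim (hS j)

/-- Necessity of `(α_n)` and `(β_n)` for the weak Deligne-Simpson problem, in the additive and in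
the multiplicative version, when one of the classes has `n` distinct eigenvalues. -/
theorem proposition2 (n p : ℕ) (hn : 2 ≤ n) (hp : 2 ≤ p) :
    (∀ c : Fin (p + 1) → ConjClasses (Mat n),
      (∃ j, HasDistinctEigenvalues (c j).carrier) →
      AdditiveWeakDSPSolvable c →
        ConditionAlpha (fun j => (c j).carrier) ∧ ConditionBeta (fun j => (c j).carrier)) ∧
    (∀ C : Fin (p + 1) → ConjClasses (GLn n),
      (∃ j, HasDistinctEigenvalues (groupClassSet (C j))) →
      MultiplicativeWeakDSPSolvable C →
        ConditionAlpha (fun j => groupClassSet (C j)) ∧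
          ConditionBeta (fun j => groupClassSet (C j))) := by
  constructor
  · rintro c - ⟨A, hAc, hsum, hA⟩
    refine ⟨conditionAlpha_of_le_sum_finrank (fun j => mem_carrier_conj (hAc j))
      (sum_finrank_range_commutatorMap_of_sum_eq_zero hA hsum), fun j => ?_⟩
    simp only [fun i => minRank_eq (hAc i)]
    exact le_sum_erase_matrixMinRank hn hA (commute_of_sum_eq_zero hsum) j
  · rintro C - ⟨M, hMC, hprod, hM⟩
    refine ⟨conditionAlpha_of_le_sum_finrank (fun j => mem_groupClassSet_conj (hMC j))
      (sum_finrank_range_commutatorMap_of_prod_eq_one hM hprod), fun j => ?_⟩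
    simp only [fun i => minRank_groupClassSet_eq (hMC i)]
    exact le_sum_erase_matrixMinRank hn hM (commute_of_prod_eq_one hprod) j
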